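/- Let $(X,\mathcal R)$ be a (symmetric) association scheme of rank $d+1\ge 3$: $X$ is a finite set, $\mathcal R=\{R_0,\dots,R_d\}$ is a partition of $X\times X$ into nonempty symmetric relations, $R_0$ is the diagonal, and there are numbers $p^h_{ij}$ such that for every $(x,y)\in R_h$ exactly $p^h_{ij}$ elements $z\in X$ satisfy $(x,z)\in R_i$ and $(z,y)\in R_j$. Let $\Gamma$ be the scheme graph of some relation $R_r$, $r\neq 0$ (the graph on $X$ in which $x,y$ are adjacent if and only if $(x,y)\in R_r$), and suppose that $\Gamma$ is connected and has valency $3$. Let $A$ be the adjacency matrix of $\Gamma$. Let $E$ be a minimal scheme idempotent of the scheme, i.e., a minimal (primitive) idempotent of the real matrix algebra generated by the $0$-$1$ adjacency matrices of the relations $R_0,\dots,R_d$. Suppose that $E$ has multiplicity three, i.e., $\operatorname{rank}E=3$, and let $\theta$ be the corresponding eigenvalue of $\Gamma$ on $E$, i.e., $AE=\theta E$. Then $$\theta\in\{1,-1,\sqrt5,-\sqrt5\}.$$ Moreover, if $\theta=\sqrt5$ or $\theta=-\sqrt5$, then $c_3=1$; that is, $\Gamma$ has vertices at distance $3$, and for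 every two vertices $x,y$ at distance $3$ in $\Gamma$, exactly one neighbour of $y$ is at distance $2$ from $x$. -/

import Mathlib

/-- A (symmetric) association scheme of rank `d + 1` on the finite set `X`. -/
structure AssociationScheme (X : Type*) [Fintype X] (d : ℕ) where
  /-- The relations `R₀, …, R_d`. -/
  R : Fin (d + 1) → Set (X × X)
  /-- The relations are the (nonempty) classes of a partition of `X × X`. -/
  nonempty : ∀ i, (R i).Nonempty
  disjoint : ∀ i j, i ≠ j → Disjoint (R i) (R j)
  cover : ⋃ i, R i = Set.univ
  /-- `R₀` is the diagonal. -/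
  diag : R 0 = {q : X × X | q.1 = q.2}
  /-- Every relation is symmetric. -/
  symm : ∀ i x y, (x, y) ∈ R i → (y, x) ∈ R i
  /-- `p h i j` is the intersection number usually written $p^h_{ij}$. -/
  p : Fin (d + 1) → Fin (d + 1) → Fin (d + 1) → ℕ
  p_spec : ∀ h i j x y, (x, y) ∈ R h → {z : X | (x, z) ∈ R i ∧ (z, y) ∈ R j}.ncard = p h i j

namespace AssociationScheme

variable {X : Type*} [Fintype X] {d : ℕ}

/-- The valency of the relation `R i`. -/
def valency (S : AssociationScheme X d) (i : Fin (d + 1)) : ℕ := S.p 0 i i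

/-- The scheme graph of the relation `R i`, for `i ≠ 0`. -/
def schemeGraph (S : AssociationScheme X d) (i : Fin (d + 1)) (hi : i ≠ 0) : SimpleGraph X where
  Adj x y := (x, y) ∈ S.R i
  symm := ⟨fun x y h => S.symm i x y h⟩
  loopless := ⟨fun x h => by
    have h0 : (x, x) ∈ S.R 0 := by rw [S.diag]; rfl
    exact Set.disjoint_left.mp (S.disjoint i 0 hi) h h0⟩

open Classical in
/-- The relation matrix (adjacency matrix) of the relation `R i`. -/
noncomputable def relMatrix (S : AssociationScheme X d) (i : Fin (d + 1)) : Matrix X X ℝ :=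
  Matrix.of fun x y => if (x, y) ∈ S.R i then 1 else 0

/-- The Bose-Mesner algebra: the matrix algebra generated by the relation matrices. -/
noncomputable def boseMesner [DecidableEq X] (S : AssociationScheme X d) :
    Subalgebra ℝ (Matrix X X ℝ) :=
  Algebra.adjoin ℝ (Set.range S.relMatrix)

/-- `E` is a minimal (primitive) idempotent of the Bose-Mesner algebra: a nonzero idempotent such
that the only idempotents `F` of the algebra lying below `E` are `0` and `E`. -/
def IsMinimalIdempotent [DecidableEq X] (S : AssociationScheme X d) (E : Matrix X X ℝ) : Prop :=
  E ∈ S.boseMesner ∧ E * E = E ∧ E ≠ 0 ∧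
    ∀ F ∈ S.boseMesner, F * F = F → E * F = F → F * E = F → F = 0 ∨ F = E

end AssociationScheme

/-- For `x`, `y` at distance `i ≥ 1` in a connected graph, the number $c_i(x, y)$ of neighbours of
`y` that are at distance `i - 1` from `x`. -/
noncomputable def SimpleGraph.cCount {V : Type*} (G : SimpleGraph V) (i : ℕ) (x y : V) : ℕ :=
  {z : V | G.Adj y z ∧ G.dist x z + 1 = i}.ncard

/-- The intersection number $c_i$ of the connected graph `G` is well defined and equal to `c`:
there are vertices at distance `i`, and $c_i(x, y) = c$ for all `x`, `y` at distance `i`. -/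
def SimpleGraph.HasIntersectionNumberC {V : Type*} (G : SimpleGraph V) (i c : ℕ) : Prop :=
  (∃ x y : V, G.dist x y = i) ∧ ∀ x y : V, G.dist x y = i → G.cCount i x y = c

/-! The columns of `E`, rescaled to unit length, represent the vertices in the 3-dimensional column
space of `E` (`IsCubicRep`). For a non-backtracking walk a, b, c, e, the inner products of `v e`
with `v b` and `v c` are known. In dimension three this fixes `v e` up to reflection in a plane, so
only two shapes occur (`three_walk`), and the two ways to continue past c realise one each
(`exists_extensions`).

Always choosing the first shape gives a walk whose differences satisfy a linear recurrence with
coefficient κ = (θ - 1) / 2. By finiteness the walk becomes periodic, so κ is an algebraic integer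
(`isIntegral`). Conjugates of θ are eigenvalues of a cubic graph, so they lie in [-3, 3], and t = κ²
+ κ = (θ² - 1) / 4 has its conjugates in [-1/4, 2]. There |t(t - 1)(t - 2)| < 1, so this algebraic
integer has norm 0, and θ² is 1, 5 or 9. The value 9 would put all the vectors on one line.

If θ² = 5, the second shape forces distance 3, and comparing two walks of equal shape gives c₃ = 1.
-/

open scoped RealInnerProductSpace

/-! ### Cubic representations in dimension three -/

/-- A representation of a cubic graph by unit vectors: adjacent vertices have inner product `θ / 3`,
and the three neighbours of a vertex sum to `θ` times that vertex. -/
structure IsCubicRep {X V : Type*} [NormedAddCommGroup V] [InnerProductSpace ℝ V]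
    (G : SimpleGraph X) (v : X → V) (θ : ℝ) : Prop where
  norm_eq : ∀ x, ‖v x‖ = 1
  inner_adj : ∀ x y, G.Adj x y → ⟪v x, v y⟫ = θ / 3
  exists_others : ∀ x y, G.Adj x y → ∃ p q, G.Adj x p ∧ G.Adj x q ∧ p ≠ y ∧ q ≠ y ∧ p ≠ q ∧
    (∀ z, G.Adj x z → z = y ∨ z = p ∨ z = q) ∧ v y + v p + v q = θ • v x

/-- In dimension three, a vector orthogonal to two independent vectors is determined by its norm
up to sign. -/
theorem eq_or_eq_neg_of_orthogonal {V : Type*} [NormedAddCommGroup V] [InnerProductSpace ℝ V]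
    (hV : Module.finrank ℝ V = 3) {p q w w' : V} (hp : ‖p‖ = 1) (hq : ‖q‖ = 1)
    (hpq : ⟪p, q⟫ ^ 2 ≠ 1) (hw : ⟪w, w⟫ = ⟪w', w'⟫) (hwp : ⟪w, p⟫ = 0) (hwq : ⟪w, q⟫ = 0)
    (hwp' : ⟪w', p⟫ = 0) (hwq' : ⟪w', q⟫ = 0) : w' = w ∨ w' = -w := by
  by_contra! hne
  have hpp : ⟪p, p⟫ = 1 := by rw [real_inner_self_eq_norm_sq, hp]; norm_num
  have hqq : ⟪q, q⟫ = 1 := by rw [real_inner_self_eq_norm_sq, hq]; norm_num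
  have hc : ⟪w, w'⟫ = ⟪w', w⟫ := real_inner_comm _ _
  have hc2 : ⟪q, p⟫ = ⟪p, q⟫ := real_inner_comm _ _
  have hpw : ⟪p, w⟫ = 0 := by rw [real_inner_comm, hwp]
  have hqw : ⟪q, w⟫ = 0 := by rw [real_inner_comm, hwq]
  have hpw' : ⟪p, w'⟫ = 0 := by rw [real_inner_comm, hwp']
  have hqw' : ⟪q, w'⟫ = 0 := by rw [real_inner_comm, hwq']
  -- Equal norms make `w' - w` and `w' + w` orthogonal; if both are nonzero, these are four nonzero
  -- orthogonal vectors in dimension three.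
  have hli : LinearIndependent ℝ ![p, q - ⟪p, q⟫ • p, w' - w, w' + w] := by
    refine linearIndependent_of_ne_zero_of_inner_eq_zero (𝕜 := ℝ) ?_ ?_
    · intro i
      fin_cases i
      · intro h
        have h0 : p = 0 := h
        simp [h0] at hp
      · intro h
        have h0 : q - ⟪p, q⟫ • p = 0 := h
        have h1 : ⟪q - ⟪p, q⟫ • p, q⟫ = 0 := by rw [h0, inner_zero_left]
        rw [inner_sub_left, inner_smul_left, hqq] at h1
        simp only [conj_trivial] at h1
        exact hpq (by linarith)
      · exact sub_ne_zero.mpr hne.1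
      · intro h
        exact hne.2 (eq_neg_of_add_eq_zero_left h)
    · intro i j hij
      fin_cases i <;> fin_cases j <;>
        first
        | exact absurd rfl hij
        | simp [inner_sub_left, inner_sub_right, inner_add_left, inner_add_right,
            inner_smul_left, inner_smul_right, -inner_self_eq_norm_sq_to_K, *]
          <;> ring
  have : FiniteDimensional ℝ V := Module.finite_of_finrank_eq_succ hV
  have h4 := hli.fintype_card_le_finrank
  rw [hV, Fintype.card_fin] at h4
  omega

namespace IsCubicRep

variable {X V : Type*} [NormedAddCommGroup V] [InnerProductSpace ℝ V]
  {G : SimpleGraph X} {v : X → V} {θ : ℝ}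

theorem inner_self (h : IsCubicRep G v θ) (x : X) : ⟪v x, v x⟫ = 1 := by
  rw [real_inner_self_eq_norm_sq, h.norm_eq]; norm_num

/-- The third neighbour is `θ • v x - v y - v z`, and its unit norm determines the inner product. -/
theorem inner_two (h : IsCubicRep G v θ) {x y z : X} (hy : G.Adj x y) (hz : G.Adj x z)
    (hyz : y ≠ z) : ⟪v y, v z⟫ = (θ ^ 2 - 3) / 6 := by
  have key : ∀ w, v y + v z + v w = θ • v x → ⟪v y, v z⟫ = (θ ^ 2 - 3) / 6 := by
    intro w hw
    have hw' : v w = θ • v x - v y - v z := by rw [← hw]; abel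
    have h1 := h.inner_self w
    have hxy := h.inner_adj x y hy
    have hxz := h.inner_adj x z hz
    have hyx : ⟪v y, v x⟫ = θ / 3 := by rw [real_inner_comm, hxy]
    have hzx : ⟪v z, v x⟫ = θ / 3 := by rw [real_inner_comm, hxz]
    have hzy : ⟪v z, v y⟫ = ⟪v y, v z⟫ := real_inner_comm _ _
    rw [hw'] at h1
    simp only [inner_sub_left, inner_sub_right, inner_smul_left, inner_smul_right, conj_trivial,
      h.inner_self, hxy, hxz, hyx, hzx, hzy] at h1
    linarith
  obtain ⟨p, q, -, -, -, -, -, hall, hsum⟩ := h.exists_others x y hy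
  rcases hall z hz with rfl | rfl | rfl
  · exact absurd rfl hyz
  · exact key q hsum
  · exact key p (by rw [← hsum]; abel)

theorem sq_lt_nine (h : IsCubicRep G v θ) (h9 : θ ^ 2 ≠ 9) {x y : X} (hxy : G.Adj x y) :
    θ ^ 2 < 9 := by
  have h1 := abs_real_inner_le_norm (v x) (v y)
  rw [h.inner_adj x y hxy, h.norm_eq, h.norm_eq, abs_le] at h1
  exact lt_of_le_of_ne (by nlinarith) h9

theorem vec_ne (h : IsCubicRep G v θ) (h9 : θ ^ 2 ≠ 9) {x y z : X} (hy : G.Adj x y)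
    (hz : G.Adj x z) (hyz : y ≠ z) : v y ≠ v z := by
  intro he
  have h1 := h.inner_two hy hz hyz
  rw [he, h.inner_self] at h1
  exact h9 (by linarith)

/-- The two possible shapes of a non-backtracking walk of length three. -/
theorem three_walk (h : IsCubicRep G v θ) (hV : Module.finrank ℝ V = 3) (h9 : θ ^ 2 ≠ 9)
    {a b c e : X} (hab : G.Adj a b) (hbc : G.Adj b c) (hce : G.Adj c e) (hac : a ≠ c)
    (hbe : b ≠ e) :
    v e = v a + ((θ + 1) / 2) • (v c - v b) ∨ v e = -v a + ((θ - 1) / 2) • (v b + v c) := by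
  have iab := h.inner_adj a b hab
  have ibc := h.inner_adj b c hbc
  have ice := h.inner_adj c e hce
  have iac := h.inner_two hab.symm hbc hac
  have ibe := h.inner_two hbc.symm hce hbe
  have icb : ⟪v c, v b⟫ = θ / 3 := by rw [real_inner_comm, ibc]
  have iba : ⟪v b, v a⟫ = θ / 3 := by rw [real_inner_comm, iab]
  have iec : ⟪v e, v c⟫ = θ / 3 := by rw [real_inner_comm, ice]
  have ica : ⟪v c, v a⟫ = (θ ^ 2 - 3) / 6 := by rw [real_inner_comm, iac]
  have ieb : ⟪v e, v b⟫ = (θ ^ 2 - 3) / 6 := by rw [real_inner_comm, ibe]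
  -- `w` and `w'` are `v a` and `v e` minus their projections onto the span of `v b` and `v c`.
  -- Reversing the walk exchanges the two computations.
  have key := eq_or_eq_neg_of_orthogonal hV (p := v b) (q := v c)
    (w := v a - ((θ / 2) • v b - (1 / 2 : ℝ) • v c))
    (w' := v e - ((θ / 2) • v c - (1 / 2 : ℝ) • v b)) (h.norm_eq b) (h.norm_eq c)
    (by rw [ibc]; intro h1; exact h9 (by linarith))
    (by simp only [inner_sub_left, inner_sub_right, inner_smul_left, inner_smul_right,
          conj_trivial, h.inner_self, *])
    (by simp only [inner_sub_left, inner_smul_left, conj_trivial, h.inner_self, *]; ring)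
    (by simp only [inner_sub_left, inner_smul_left, conj_trivial, h.inner_self, *]; ring)
    (by simp only [inner_sub_left, inner_smul_left, conj_trivial, h.inner_self, *]; ring)
    (by simp only [inner_sub_left, inner_smul_left, conj_trivial, h.inner_self, *]; ring)
  rcases key with hk | hk
  · left
    rw [sub_eq_iff_eq_add] at hk
    rw [hk]; module
  · right
    rw [sub_eq_iff_eq_add] at hk
    rw [hk]; module

/-- Every non-backtracking walk of length two extends to walks of length three of both shapes. -/
theorem exists_extensions (h : IsCubicRep G v θ) (hV : Module.finrank ℝ V = 3) (h9 : θ ^ 2 ≠ 9)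
    {a b c : X} (hab : G.Adj a b) (hbc : G.Adj b c) (hac : a ≠ c) :
    (∃ e, G.Adj c e ∧ b ≠ e ∧ v e = v a + ((θ + 1) / 2) • (v c - v b)) ∧
      ∃ e, G.Adj c e ∧ b ≠ e ∧ v e = -v a + ((θ - 1) / 2) • (v b + v c) := by
  obtain ⟨p, q, hp, hq, hpb, hqb, -, -, hsum⟩ := h.exists_others c b hbc.symm
  have hq' : v q = θ • v c - v b - v p := by rw [← hsum]; abel
  -- The two shapes sum to `θ • v c - v b`, so if `p` has one, `q` has the other.
  rcases h.three_walk hV h9 hab hbc hp hac hpb.symm with hk | hk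
  · refine ⟨⟨p, hp, hpb.symm, hk⟩, q, hq, hqb.symm, ?_⟩
    rw [hq', hk]; module
  · refine ⟨⟨q, hq, hqb.symm, ?_⟩, p, hp, hpb.symm, hk⟩
    rw [hq', hk]; module

end IsCubicRep

/-! ### Integrality of (θ - 1) / 2 -/

/-- A solution of `d (n + 2) = κ • d (n + 1) - d n` is given by monic integer polynomials in `κ`. -/
theorem exists_monic_of_recurrence {V : Type*} [AddCommGroup V] [Module ℝ V] {κ : ℝ} {u : ℕ → V}
    (hu : ∀ n, u (n + 2) = κ • u (n + 1) - u n) (n : ℕ) :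
    ∃ P Q P' Q' : Polynomial ℤ, P.Monic ∧ P'.Monic ∧ P.natDegree = n ∧ P'.natDegree = n + 1 ∧
      u (n + 1) = (Polynomial.aeval κ P) • u 1 + (Polynomial.aeval κ Q) • u 0 ∧
      u (n + 2) = (Polynomial.aeval κ P') • u 1 + (Polynomial.aeval κ Q') • u 0 := by
  induction n with
  | zero =>
    refine ⟨1, 0, Polynomial.X, -1, Polynomial.monic_one, Polynomial.monic_X, by simp, by simp,
      by simp, ?_⟩
    rw [hu 0]; simp; module
  | succ n ih =>
    obtain ⟨P, Q, P', Q', hP, hP', hd, hd', h1, h2⟩ := ih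
    have hdeg : (Polynomial.X * P').natDegree = n + 2 := by
      rw [Polynomial.natDegree_X_mul hP'.ne_zero, hd']
    have hlt : P.degree < (Polynomial.X * P').degree := by
      apply Polynomial.degree_lt_degree
      rw [hdeg, hd]; omega
    refine ⟨P', Q', Polynomial.X * P' - P, Polynomial.X * Q' - Q, hP',
      (Polynomial.monic_X.mul hP').sub_of_left hlt, hd', ?_, h2, ?_⟩
    · rw [Polynomial.natDegree_sub_eq_left_of_natDegree_lt, hdeg]
      rw [hdeg, hd]; omega
    · rw [hu (n + 1), h2, h1]
      simp only [map_sub, map_mul, Polynomial.aeval_X]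
      module

namespace IsCubicRep

variable {X V : Type*} [NormedAddCommGroup V] [InnerProductSpace ℝ V]
  {G : SimpleGraph X} {v : X → V} {θ : ℝ}

theorem isIntegral [Finite X] (h : IsCubicRep G v θ) (hV : Module.finrank ℝ V = 3)
    (h9 : θ ^ 2 ≠ 9) {x y : X} (hxy : G.Adj x y) : IsIntegral ℤ ((θ - 1) / 2) := by
  -- Non-backtracking walks of length two; `f` below shifts such a walk one step along the first
  -- shape.
  let T := {t : X × X × X // G.Adj t.1 t.2.1 ∧ G.Adj t.2.1 t.2.2 ∧ t.1 ≠ t.2.2}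
  have hstep : ∀ t : T, ∃ t' : T, t'.1.1 = t.1.2.1 ∧ t'.1.2.1 = t.1.2.2 ∧
      v t'.1.2.2 = v t.1.1 + ((θ + 1) / 2) • (v t.1.2.2 - v t.1.2.1) := by
    rintro ⟨⟨a, b, c⟩, hab, hbc, hac⟩
    obtain ⟨⟨e, hce, hbe, he⟩, -⟩ := h.exists_extensions hV h9 hab hbc hac
    exact ⟨⟨⟨b, c, e⟩, hbc, hce, hbe⟩, rfl, rfl, he⟩
  choose f hf1 hf2 hf3 using hstep
  obtain ⟨p, -, hp, -, hpx, -⟩ := h.exists_others y x hxy.symm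
  let t₀ : T := ⟨⟨x, y, p⟩, hxy, hp, hpx.symm⟩
  obtain ⟨m, n, hmn, heq⟩ : ∃ m n, m < n ∧ f^[m] t₀ = f^[n] t₀ := by
    obtain ⟨m, n, hne, heq⟩ := Finite.exists_ne_map_eq_of_infinite fun n : ℕ => f^[n] t₀
    rcases lt_or_gt_of_ne hne with hlt | hlt
    · exact ⟨m, n, hlt, heq⟩
    · exact ⟨n, m, hlt, heq.symm⟩
  let t : ℕ → T := fun k => f^[k + m] t₀
  have ht : ∀ k, t (k + 1) = f (t k) := by
    intro k
    change f^[k + 1 + m] t₀ = f (f^[k + m] t₀)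
    rw [← Function.iterate_succ_apply' f, show k + 1 + m = (k + m).succ by omega]
  obtain ⟨N, rfl⟩ : ∃ N, n = N + 1 + m := ⟨n - m - 1, by omega⟩
  have htN : t (N + 1) = t 0 := by
    change f^[N + 1 + m] t₀ = f^[0 + m] t₀
    rw [← heq, zero_add]
  let u : ℕ → V := fun k => v (t k).1.2.1 - v (t k).1.1
  have hu1 : ∀ k, u (k + 1) = v (t k).1.2.2 - v (t k).1.2.1 := by
    intro k
    simp only [u, ht, hf1, hf2]
  have hu : ∀ k, u (k + 2) = ((θ - 1) / 2) • u (k + 1) - u k := by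
    intro k
    rw [hu1 (k + 1), hu1 k]
    simp only [u, ht, hf2, hf3]
    module
  obtain ⟨P, Q, -, -, hP, -, -, -, hN, -⟩ := exists_monic_of_recurrence hu N
  have huN : u (N + 1) = u 0 := by simp only [u, htN]
  refine ⟨P, hP, ?_⟩
  rw [← Polynomial.aeval_def]
  by_contra hne
  set α := Polynomial.aeval ((θ - 1) / 2) P
  set β := Polynomial.aeval ((θ - 1) / 2) Q
  obtain ⟨hab, hbc, hac⟩ := (t 0).2
  set a := (t 0).1.1
  set b := (t 0).1.2.1
  set c := (t 0).1.2.2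
  -- Periodicity gives a relation between consecutive differences. Since θ² ≠ 9 these are
  -- independent, which forces α = 0; pairing with `v a` and `v b` shows it.
  have hrel : α • (v c - v b) = (1 - β) • (v b - v a) := by
    have h0 : u 0 = v b - v a := rfl
    have h1 : u 1 = v c - v b := hu1 0
    rw [huN, h0, h1] at hN
    rw [sub_smul, one_smul]
    exact eq_sub_of_add_eq hN.symm
  have hlt := h.sq_lt_nine h9 hab
  have iab := h.inner_adj a b hab
  have ibc := h.inner_adj b c hbc
  have iac := h.inner_two hab.symm hbc hac
  have icb : ⟪v c, v b⟫ = θ / 3 := by rw [real_inner_comm, ibc]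
  have iba : ⟪v b, v a⟫ = θ / 3 := by rw [real_inner_comm, iab]
  have ica : ⟪v c, v a⟫ = (θ ^ 2 - 3) / 6 := by rw [real_inner_comm, iac]
  have e1 := congrArg (fun w => ⟪w, v a⟫) hrel
  have e2 := congrArg (fun w => ⟪w, v b⟫) hrel
  simp only [inner_sub_left, inner_smul_left, conj_trivial, h.inner_self, iab, iba, ica, icb]
    at e1 e2
  have h3 : (3 - θ) ≠ 0 := by intro h0; exact h9 (by nlinarith)
  have hβ : α = -(1 - β) := by
    apply mul_right_cancel₀ h3; linarith
  have : α * (θ ^ 2 - 9) = 0 := by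
    have : (1 - β) = -α := by linarith
    rw [this] at e1; linarith
  rcases mul_eq_zero.mp this with h0 | h0
  · exact hne h0
  · exact h9 (by linarith)

/-! ### Distance three when θ² = 5 -/

theorem inner_three (h : IsCubicRep G v θ) (hV : Module.finrank ℝ V = 3) (h5 : θ ^ 2 = 5)
    {a b c e : X} (hab : G.Adj a b) (hbc : G.Adj b c) (hce : G.Adj c e) (hac : a ≠ c)
    (hbe : b ≠ e) :
    (⟪v a, v e⟫ = 1 / 3 ∧ v e = v a + ((θ + 1) / 2) • (v c - v b)) ∨
      (⟪v a, v e⟫ = -1 / 3 ∧ v e = -v a + ((θ - 1) / 2) • (v b + v c)) := by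
  have iab := h.inner_adj a b hab
  have iac := h.inner_two hab.symm hbc hac
  refine (h.three_walk hV (by rw [h5]; norm_num) hab hbc hce hac hbe).imp ?_ ?_ <;>
  · intro he
    refine ⟨?_, he⟩
    rw [he]
    simp only [inner_sub_right, inner_add_right, inner_neg_right, inner_smul_right, h.inner_self,
      iab, iac]
    rw [h5]
    linarith

theorem hasIntersectionNumberC [Finite X] (h : IsCubicRep G v θ) (hV : Module.finrank ℝ V = 3)
    (hG : G.Connected) (h5 : θ ^ 2 = 5) {x₀ y₀ : X} (hxy₀ : G.Adj x₀ y₀) :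
    G.HasIntersectionNumberC 3 1 := by
  have h9 : θ ^ 2 ≠ 9 := by rw [h5]; norm_num
  have walk2 : ∀ x z, G.dist x z = 2 → ∃ y, G.Adj x y ∧ G.Adj y z ∧ x ≠ z := by
    intro x z hxz
    obtain ⟨w, hw⟩ := hG.exists_walk_length_eq_dist x z
    rw [hxz] at hw
    cases w with
    | nil => simp at hw
    | cons h1 w =>
      cases w with
      | nil => simp at hw
      | cons h2 w =>
        cases w with
        | nil => exact ⟨_, h1, h2, by rintro rfl; simp at hxz⟩
        | cons h3 w => simp at hw
  have dist_one : ∀ x y, G.Adj x y → G.dist x y = 1 := fun x y hxy =>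
    SimpleGraph.dist_eq_one_iff_adj.mpr hxy
  refine ⟨?_, ?_⟩
  · obtain ⟨c, -, hc, -, hca, -⟩ := h.exists_others y₀ x₀ hxy₀.symm
    -- The second shape has inner product -1/3, whereas distances 0, 1, 2 give 1, θ/3, 1/3.
    obtain ⟨-, e, hce, hbe, he⟩ := h.exists_extensions hV h9 hxy₀ hc hca.symm
    have hi : ⟪v x₀, v e⟫ = -1 / 3 := by
      have iab := h.inner_adj x₀ y₀ hxy₀
      have iac := h.inner_two hxy₀.symm hc hca.symm
      rw [he]
      simp only [inner_add_right, inner_neg_right, inner_smul_right, h.inner_self, iab, iac]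
      rw [h5]
      linarith
    refine ⟨x₀, e, ?_⟩
    have hle : G.dist x₀ e ≤ 3 := SimpleGraph.dist_le (.cons hxy₀ (.cons hc (.cons hce .nil)))
    have h0 : G.dist x₀ e ≠ 0 := by
      intro h0
      rw [hG.dist_eq_zero_iff] at h0
      rw [← h0, h.inner_self] at hi
      norm_num at hi
    have h1 : G.dist x₀ e ≠ 1 := by
      intro h1
      rw [SimpleGraph.dist_eq_one_iff_adj] at h1
      rw [h.inner_adj _ _ h1] at hi
      nlinarith
    have h2 : G.dist x₀ e ≠ 2 := by
      intro h2
      obtain ⟨y, hy, hy', hne⟩ := walk2 _ _ h2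
      rw [h.inner_two hy.symm hy' hne, h5] at hi
      norm_num at hi
    omega
  · intro x y hxy
    unfold SimpleGraph.cCount
    rw [Set.ncard_eq_one]
    obtain ⟨z, hz, hzx⟩ : ∃ z, G.Adj y z ∧ G.dist x z + 1 = 3 := by
      obtain ⟨w, hw⟩ := hG.exists_walk_length_eq_dist y x
      cases w with
      | nil => simp at hxy
      | @cons _ z _ h1 w =>
        refine ⟨z, h1, ?_⟩
        have := SimpleGraph.dist_le w
        have h2 := hG.dist_triangle (u := x) (v := z) (w := y)
        rw [dist_one _ _ h1.symm] at h2
        rw [SimpleGraph.Walk.length_cons, SimpleGraph.dist_comm] at hw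
        rw [SimpleGraph.dist_comm] at this
        omega
    refine ⟨z, Set.eq_singleton_iff_unique_mem.mpr ⟨⟨hz, hzx⟩, ?_⟩⟩
    rintro z' ⟨hz', hzx'⟩
    by_contra hne
    obtain ⟨w, hxw, hwz, hxz⟩ := walk2 x z (by omega)
    obtain ⟨w', hxw', hwz', hxz'⟩ := walk2 x z' (by omega)
    have hwy : ∀ w, G.Adj x w → w ≠ y := by
      rintro w hw rfl
      rw [dist_one _ _ hw] at hxy
      omega
    have hv : v z' ≠ v z := h.vec_ne h9 hz' hz hne
    have t1 := h.inner_three hV h5 hxw hwz hz.symm hxz (hwy w hxw)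
    have t2 := h.inner_three hV h5 hxw' hwz' hz'.symm hxz' (hwy w' hxw')
    have hi : w ≠ w' → ⟪v z, v w'⟫ = 1 / 3 ∨ ⟪v z, v w'⟫ = -1 / 3 := fun hww =>
      (h.inner_three hV h5 hwz.symm hxw.symm hxw' hxz.symm hww).imp And.left And.left
    have iww := h.inner_self w'
    have iwz : ⟪v z', v w'⟫ = θ / 3 := h.inner_adj _ _ hwz'.symm
    -- Both walks end at x and y, so their shapes agree. Cancelling leaves a relation among z, w,
    -- z', w'; pairing it with `v w'` contradicts `hi` when w ≠ w'.
    rcases t1 with ⟨i1, e1⟩ | ⟨i1, e1⟩ <;> rcases t2 with ⟨i2, e2⟩ | ⟨i2, e2⟩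
    · have hne0 : (θ + 1) / 2 ≠ 0 := by intro h0; nlinarith
      have hd : v z - v w = v z' - v w' := by
        apply smul_right_injective V hne0
        exact add_left_cancel (e1.symm.trans e2)
      by_cases hww : w = w'
      · subst hww
        exact hv (sub_left_injective hd).symm
      · have hc := congrArg (fun s => ⟪s, v w'⟫) hd
        simp only [inner_sub_left, iww, iwz, h.inner_two hxw hxw' hww, h5] at hc
        rcases hi hww with hh | hh <;> rw [hh] at hc <;> nlinarith
    · rw [i1] at i2; norm_num at i2
    · rw [i1] at i2; norm_num at i2
    · have hne0 : (θ - 1) / 2 ≠ 0 := by intro h0; nlinarith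
      have hd : v w + v z = v w' + v z' := by
        apply smul_right_injective V hne0
        exact add_left_cancel (e1.symm.trans e2)
      by_cases hww : w = w'
      · subst hww
        exact hv (add_left_cancel hd).symm
      · have hc := congrArg (fun s => ⟪s, v w'⟫) hd
        simp only [inner_add_left, iww, iwz, h.inner_two hxw hxw' hww, h5] at hc
        rcases hi hww with hh | hh <;> rw [hh] at hc <;> nlinarith

end IsCubicRep

/-! ### Conjugates and eigenvalue bounds -/

/-- An integer polynomial expression in an algebraic integer vanishes if all its conjugates have
absolute value less than one. -/
theorem aeval_eq_zero_of_conjugates_lt_one {κ : ℝ} (hκ : IsIntegral ℤ κ) (f : Polynomial ℤ)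
    (hf : ∀ z : ℂ, (∀ p : Polynomial ℤ, Polynomial.aeval κ p = 0 → Polynomial.aeval z p = 0) →
      ‖Polynomial.aeval z f‖ < 1) : Polynomial.aeval κ f = 0 := by
  have hκ' : IsIntegral ℚ κ := hκ.tower_top
  have := IntermediateField.adjoin.finiteDimensional hκ'
  let K := IntermediateField.adjoin ℚ {κ}
  let g : K := IntermediateField.AdjoinSimple.gen ℚ κ
  have hg : algebraMap K ℝ g = κ := IntermediateField.AdjoinSimple.algebraMap_gen ℚ κ
  have hgi : IsIntegral ℤ g := by
    rw [← isIntegral_algebraMap_iff (algebraMap K ℝ).injective, hg]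
    exact hκ
  have hmap : ∀ p : Polynomial ℤ, algebraMap K ℝ (Polynomial.aeval g p) = Polynomial.aeval κ p := by
    intro p
    rw [← Polynomial.aeval_algebraMap_apply, hg]
  have hy : IsIntegral ℤ (Polynomial.aeval g f) :=
    adjoin_le_integralClosure hgi (Polynomial.aeval_mem_adjoin_singleton ℤ g)
  obtain ⟨n, hn⟩ := IsIntegrallyClosed.isIntegral_iff.mp (Algebra.isIntegral_norm ℚ hy)
  have hprod := Algebra.norm_eq_prod_embeddings ℚ ℂ (Polynomial.aeval g f)
  have hσ : ∀ (σ : K →ₐ[ℚ] ℂ) (p : Polynomial ℤ),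
      σ (Polynomial.aeval g p) = Polynomial.aeval (σ g) p := by
    intro σ p
    exact (Polynomial.aeval_algHom_apply (σ.restrictScalars ℤ) g p).symm
  have hlt : ∀ σ : K →ₐ[ℚ] ℂ, ‖σ (Polynomial.aeval g f)‖ < 1 := by
    intro σ
    rw [hσ]
    apply hf
    intro p hp
    rw [← hmap, map_eq_zero] at hp
    rw [← hσ, hp, map_zero]
  have hnorm : Algebra.norm ℚ (Polynomial.aeval g f) = 0 := by
    rw [← hn] at hprod ⊢
    have h1 : ‖((n : ℤ) : ℂ)‖ < 1 := by
      have : (algebraMap ℚ ℂ) ((algebraMap ℤ ℚ) n) = (n : ℂ) := by simp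
      rw [← this, hprod, norm_prod]
      classical
      -- One embedding is split off to make the bound on the product strict.
      let σ : K →ₐ[ℚ] ℂ := IsAlgClosed.lift
      rw [← Finset.mul_prod_erase _ _ (Finset.mem_univ σ)]
      refine lt_of_le_of_lt (mul_le_of_le_one_right (norm_nonneg _) ?_) (hlt σ)
      exact Finset.prod_le_one (fun _ _ => norm_nonneg _) fun τ _ => (hlt τ).le
    rw [Complex.norm_intCast] at h1
    have h2 : |n| < 1 := by exact_mod_cast h1
    rw [Int.abs_lt_one_iff] at h2
    rw [h2, map_zero]
  rw [Algebra.norm_eq_zero_iff] at hnorm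
  rw [← hmap, hnorm, map_zero]

theorem abs_aux_lt_one {s : ℝ} (hs : |s| ≤ 3) :
    |((s ^ 2 - 1) / 4) * ((s ^ 2 - 1) / 4 - 1) * ((s ^ 2 - 1) / 4 - 2)| < 1 := by
  have h9 : s ^ 2 ≤ 9 := by
    rw [abs_le] at hs
    nlinarith
  have h0 : 0 ≤ s ^ 2 := sq_nonneg s
  obtain ⟨t, ht⟩ : ∃ t, t = (s ^ 2 - 1) / 4 := ⟨_, rfl⟩
  rw [← ht]
  have h1 : -1 / 4 ≤ t := by rw [ht]; linarith
  have h2 : t ≤ 2 := by rw [ht]; linarith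
  rw [abs_lt]
  constructor
  · nlinarith [mul_nonneg (sub_nonneg.mpr h1) (sq_nonneg (t - 1)),
      mul_nonneg (sub_nonneg.mpr h1) (sq_nonneg t), sq_nonneg (t - 1), sq_nonneg t]
  · nlinarith [mul_nonneg (sub_nonneg.mpr h2) (sq_nonneg (t - 1)),
      mul_nonneg (sub_nonneg.mpr h2) (sq_nonneg t), sq_nonneg (t - 1), sq_nonneg t,
      sq_nonneg (2 * t - 1)]

/-- If all conjugates of `θ` lie in `[-3, 3]` and `(θ - 1) / 2` is an algebraic integer, then
`θ ^ 2 ∈ {1, 5, 9}`. -/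
theorem sq_eq_of_conjugates {θ : ℝ} (hκ : IsIntegral ℤ ((θ - 1) / 2)) (p : Polynomial ℤ)
    (hp : Polynomial.aeval θ p = 0)
    (hroots : ∀ z : ℂ, Polynomial.aeval z p = 0 → ∃ s : ℝ, z = s ∧ |s| ≤ 3) :
    θ ^ 2 = 1 ∨ θ ^ 2 = 5 ∨ θ ^ 2 = 9 := by
  open Polynomial in
  have h := aeval_eq_zero_of_conjugates_lt_one hκ
    ((X ^ 2 + X) * (X ^ 2 + X - 1) * (X ^ 2 + X - 2)) (by
      intro z hz
      -- With κ = (θ - 1) / 2 one has θ = 2κ + 1, so conjugates of κ map to roots of `p`.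
      have h1 := hz (p.comp (2 * X + 1)) (by
        rw [aeval_comp]
        simp only [map_add, map_mul, aeval_X, map_one, map_ofNat]
        rw [mul_div_cancel₀ _ two_ne_zero, sub_add_cancel, hp])
      rw [aeval_comp] at h1
      obtain ⟨s, hs, hs3⟩ := hroots _ h1
      simp only [map_add, map_mul, aeval_X, map_one, map_ofNat] at hs
      have hz' : z = (((s - 1) / 2 : ℝ) : ℂ) := by
        push_cast
        rw [← hs]; ring
      have he : aeval z ((X ^ 2 + X) * (X ^ 2 + X - 1) * (X ^ 2 + X - 2) : ℤ[X]) =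
          ((((s ^ 2 - 1) / 4) * ((s ^ 2 - 1) / 4 - 1) * ((s ^ 2 - 1) / 4 - 2) : ℝ) : ℂ) := by
        rw [hz']
        simp only [map_add, map_sub, map_mul, map_pow, aeval_X, map_one, map_ofNat]
        push_cast
        ring
      rw [he, Complex.norm_real]
      exact abs_aux_lt_one hs3)
  simp only [map_add, map_sub, map_mul, map_pow, Polynomial.aeval_X, map_one, map_ofNat] at h
  rcases mul_eq_zero.mp h with h | h
  · rcases mul_eq_zero.mp h with h | h
    · left; linarith
    · right; left; linarith
  · right; right; linarith

/-- The eigenvalues of a symmetric integer matrix with zero diagonal and absolute row sums at most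
three are real and lie in `[-3, 3]`. -/
theorem exists_real_of_aeval_charpoly {X : Type*} [Fintype X] [DecidableEq X]
    (B : Matrix X X ℤ) (hB : B.IsSymm) (hdiag : ∀ x, B x x = 0) (hsum : ∀ x, ∑ y, |B x y| ≤ 3)
    (z : ℂ) (hz : Polynomial.aeval z B.charpoly = 0) : ∃ s : ℝ, z = s ∧ |s| ≤ 3 := by
  let C : Matrix X X ℂ := B.map (algebraMap ℤ ℂ)
  have hC : C.IsHermitian := by
    ext i j
    simp [C, hB.apply i j]
  have hroot : C.charpoly.IsRoot z := by
    rw [Matrix.charpoly_map, Polynomial.IsRoot, Polynomial.eval_map_algebraMap, hz]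
  have hspec := Matrix.mem_spectrum_iff_isRoot_charpoly.mpr hroot
  have hev : Module.End.HasEigenvalue (Matrix.toLin' C) z := by
    rw [Module.End.hasEigenvalue_iff_mem_spectrum, Matrix.spectrum_toLin']
    exact hspec
  rw [hC.spectrum_eq_image_range] at hspec
  obtain ⟨s, -, hs⟩ := hspec
  refine ⟨s, hs.symm, ?_⟩
  -- Gershgorin: the disc is centred at a diagonal entry, which is 0.
  obtain ⟨k, hk⟩ := eigenvalue_mem_ball hev
  have h1 : C k k = 0 := by simp [C, hdiag]
  rw [h1, mem_closedBall_zero_iff] at hk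
  have h2 : ‖z‖ = |s| := by
    rw [← hs]
    exact Complex.norm_real s
  rw [← h2]
  refine hk.trans ?_
  have h3 : ∀ j, ‖C k j‖ = ((|B k j| : ℤ) : ℝ) := by
    intro j
    simp [C]
  calc ∑ j ∈ Finset.univ.erase k, ‖C k j‖ ≤ ∑ j, ‖C k j‖ :=
        Finset.sum_le_sum_of_subset_of_nonneg (Finset.erase_subset _ _) fun _ _ _ => norm_nonneg _
    _ = ((∑ j, |B k j| : ℤ) : ℝ) := by
        push_cast
        exact Finset.sum_congr rfl fun j _ => by rw [h3]; push_cast; rfl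
    _ ≤ 3 := by exact_mod_cast hsum k

/-! ### Entries of Bose-Mesner matrices -/

namespace AssociationScheme

variable {X : Type*} [Fintype X] {d : ℕ} (S : AssociationScheme X d)

theorem exists_rel (x y : X) : ∃ i, (x, y) ∈ S.R i := by
  have h : (x, y) ∈ ⋃ i, S.R i := by rw [S.cover]; trivial
  simpa using h

theorem rel_unique {x y : X} {i j : Fin (d + 1)} (hi : (x, y) ∈ S.R i) (hj : (x, y) ∈ S.R j) :
    i = j := by
  by_contra hne
  exact Set.disjoint_left.mp (S.disjoint i j hne) hi hj

/-- The entries of a matrix in the Bose-Mesner algebra depend only on the relation. -/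
theorem exists_coeff_of_mem_boseMesner [DecidableEq X] {M : Matrix X X ℝ}
    (hM : M ∈ S.boseMesner) :
    ∃ f : Fin (d + 1) → ℝ, ∀ i x y, (x, y) ∈ S.R i → M x y = f i := by
  classical
  induction hM using Algebra.adjoin_induction with
  | mem M hM =>
    obtain ⟨j, rfl⟩ := hM
    refine ⟨fun i => if i = j then 1 else 0, fun i x y h => ?_⟩
    simp only [relMatrix, Matrix.of_apply]
    congr 1
    exact propext ⟨fun h' => S.rel_unique h h', fun h' => h' ▸ h⟩
  | algebraMap a =>
    refine ⟨fun i => if i = 0 then a else 0, fun i x y h => ?_⟩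
    rw [Matrix.algebraMap_matrix_apply]
    have : x = y ↔ i = 0 := by
      constructor
      · rintro rfl
        exact S.rel_unique h (by rw [S.diag]; rfl)
      · rintro rfl
        rw [S.diag] at h
        exact h
    simp [this]
  | add M N _ _ hM hN =>
    obtain ⟨f, hf⟩ := hM
    obtain ⟨g, hg⟩ := hN
    exact ⟨f + g, fun i x y h => by rw [Matrix.add_apply, hf i x y h, hg i x y h]; rfl⟩
  | mul M N _ _ hM hN =>
    obtain ⟨f, hf⟩ := hM
    obtain ⟨g, hg⟩ := hN
    -- Sorting the intermediate vertices z by the relations of (x, z) and (z, y) produces the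
    -- intersection numbers.
    refine ⟨fun h => ∑ i, ∑ j, (S.p h i j : ℝ) * (f i * g j), fun h x y hxy => ?_⟩
    rw [Matrix.mul_apply]
    have key : ∀ z, M x z * N z y =
        ∑ i, ∑ j, if (x, z) ∈ S.R i ∧ (z, y) ∈ S.R j then f i * g j else 0 := by
      intro z
      obtain ⟨i, hi⟩ := S.exists_rel x z
      obtain ⟨j, hj⟩ := S.exists_rel z y
      rw [Finset.sum_eq_single i, Finset.sum_eq_single j, if_pos ⟨hi, hj⟩, hf i x z hi,
        hg j z y hj]
      · intro j' _ hne
        exact if_neg fun h' => hne (S.rel_unique h'.2 hj)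
      · simp
      · intro i' _ hne
        exact Finset.sum_eq_zero fun j' _ => if_neg fun h' => hne (S.rel_unique h'.1 hi)
      · simp
    rw [Finset.sum_congr rfl fun z _ => key z, Finset.sum_comm]
    refine Finset.sum_congr rfl fun i _ => ?_
    rw [Finset.sum_comm]
    refine Finset.sum_congr rfl fun j _ => ?_
    rw [← S.p_spec h i j x y hxy, Finset.sum_ite, Finset.sum_const_zero, add_zero,
      Finset.sum_const, nsmul_eq_mul, Set.ncard_eq_toFinset_card']
    congr 3
    ext z
    simp

theorem isSymm_of_mem_boseMesner [DecidableEq X] {M : Matrix X X ℝ} (hM : M ∈ S.boseMesner) :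
    M.IsSymm := by
  obtain ⟨f, hf⟩ := S.exists_coeff_of_mem_boseMesner hM
  ext x y
  obtain ⟨i, hi⟩ := S.exists_rel x y
  rw [Matrix.transpose_apply, hf i x y hi, hf i y x (S.symm i x y hi)]

theorem ncard_neighbors (r : Fin (d + 1)) (x : X) :
    {y : X | (x, y) ∈ S.R r}.ncard = S.valency r := by
  rw [valency, ← S.p_spec 0 r r x x (by rw [S.diag]; rfl)]
  congr 1
  ext y
  exact ⟨fun h => ⟨h, S.symm r x y h⟩, fun h => h.1⟩

end AssociationScheme

/-! ### The representation by columns of an idempotent -/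

/-- The `x`-th column of `E`, as a vector in the column space of `E`, divided by `√c`. -/
noncomputable def scaledCol {X : Type*} [Fintype X] [DecidableEq X] (E : Matrix X X ℝ) (c : ℝ)
    (x : X) : LinearMap.range (Matrix.toEuclideanLin E) :=
  (√c)⁻¹ • ⟨Matrix.toEuclideanLin E (EuclideanSpace.single x 1), LinearMap.mem_range_self _ _⟩

section ScaledCol

variable {X : Type*} [Fintype X] [DecidableEq X] {E : Matrix X X ℝ} {c : ℝ}

theorem coe_scaledCol_apply (x z : X) :
    (scaledCol E c x : EuclideanSpace ℝ X) z = (√c)⁻¹ * E z x := by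
  simp [scaledCol, Matrix.toLpLin_apply]

/-- A symmetric idempotent is the Gram matrix of its own columns. -/
theorem inner_scaledCol (hc : 0 < c) (hE : E.IsSymm) (hEE : E * E = E) (x y : X) :
    ⟪scaledCol E c x, scaledCol E c y⟫ = E x y / c := by
  have h : ⟪scaledCol E c x, scaledCol E c y⟫ =
      ⟪(scaledCol E c x : EuclideanSpace ℝ X), (scaledCol E c y : EuclideanSpace ℝ X)⟫ := rfl
  rw [h, PiLp.inner_apply]
  simp only [coe_scaledCol_apply, RCLike.inner_apply, conj_trivial]
  have hs : (√c)⁻¹ * (√c)⁻¹ = c⁻¹ := by rw [← mul_inv, Real.mul_self_sqrt hc.le]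
  calc ∑ z, (√c)⁻¹ * E z y * ((√c)⁻¹ * E z x)
      = ∑ z, c⁻¹ * (E x z * E z y) :=
        Finset.sum_congr rfl fun z _ => by rw [hE.apply x z, ← hs]; ring
    _ = E x y / c := by
        rw [← Finset.mul_sum, ← Matrix.mul_apply, hEE, div_eq_inv_mul]

theorem finrank_range_toEuclideanLin :
    Module.finrank ℝ (LinearMap.range (Matrix.toEuclideanLin E)) = E.rank := by
  rw [Matrix.rank_eq_finrank_range_toLin E (PiLp.basisFun 2 ℝ X) (PiLp.basisFun 2 ℝ X),
    ← Matrix.toLpLin_eq_toLin]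

theorem span_range_scaledCol (hc : 0 < c) :
    Submodule.span ℝ (Set.range (scaledCol E c)) = ⊤ := by
  rw [eq_top_iff]
  rintro ⟨_, w, rfl⟩ -
  have hs : √c ≠ 0 := (Real.sqrt_pos.mpr hc).ne'
  have hw : (⟨Matrix.toEuclideanLin E w, LinearMap.mem_range_self _ w⟩ :
      LinearMap.range (Matrix.toEuclideanLin E)) = ∑ x, (w x * √c) • scaledCol E c x := by
    ext z
    simp only [Submodule.coe_sum, Submodule.coe_smul, WithLp.ofLp_sum, WithLp.ofLp_smul,
      Finset.sum_apply, Pi.smul_apply, smul_eq_mul, coe_scaledCol_apply]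
    simp only [Matrix.toLpLin_apply, Matrix.mulVec, dotProduct]
    refine Finset.sum_congr rfl fun x _ => ?_
    field_simp
  rw [hw]
  exact Submodule.sum_mem _ fun x _ => Submodule.smul_mem _ _ (Submodule.subset_span ⟨x, rfl⟩)

end ScaledCol

namespace AssociationScheme

variable {X : Type*} [Fintype X] {d : ℕ} (S : AssociationScheme X d)

theorem exists_neighbors (r : Fin (d + 1)) (hval : S.valency r = 3) {x y : X}
    (hxy : (x, y) ∈ S.R r) : ∃ p q, p ≠ y ∧ q ≠ y ∧ p ≠ q ∧
      {z : X | (x, z) ∈ S.R r} = {y, p, q} := by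
  have h3 := S.ncard_neighbors r x
  rw [hval, Set.ncard_eq_three] at h3
  obtain ⟨a, b, c, hab, hac, hbc, hset⟩ := h3
  have hy : y ∈ ({a, b, c} : Set X) := hset ▸ hxy
  rcases hy with rfl | rfl | rfl
  · exact ⟨b, c, hab.symm, hac.symm, hbc, hset⟩
  · exact ⟨a, c, hab, hbc.symm, hac, by rw [hset, Set.insert_comm]⟩
  · refine ⟨a, b, hac, hbc, hab, ?_⟩
    rw [hset]
    ext z
    simp only [Set.mem_insert_iff, Set.mem_singleton_iff]
    tauto

theorem relMatrix_mul_apply (r : Fin (d + 1)) (E : Matrix X X ℝ) {x y p q : X} (hpy : p ≠ y)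
    (hqy : q ≠ y) (hpq : p ≠ q) (hset : {z : X | (x, z) ∈ S.R r} = {y, p, q}) (z : X) :
    (S.relMatrix r * E) x z = E y z + E p z + E q z := by
  classical
  have hmem : ∀ w, (x, w) ∈ S.R r ↔ w ∈ ({y, p, q} : Finset X) := by
    intro w
    have : w ∈ {z : X | (x, z) ∈ S.R r} ↔ w ∈ ({y, p, q} : Set X) := by rw [hset]
    simpa using this
  rw [Matrix.mul_apply]
  simp only [relMatrix, Matrix.of_apply, hmem, ite_mul, one_mul, zero_mul]
  rw [Finset.sum_ite_mem, Finset.univ_inter, Finset.sum_insert, Finset.sum_insert,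
    Finset.sum_singleton, add_assoc]
  · simpa using hpq
  · simpa using ⟨hpy.symm, hqy.symm⟩

/-- By symmetry and idempotence, a diagonal entry is the sum of squares of its row. -/
theorem exists_diag_pos [DecidableEq X] {E : Matrix X X ℝ} (hE : E ∈ S.boseMesner)
    (hEE : E * E = E) (h0 : E ≠ 0) : ∃ c, 0 < c ∧ ∀ x, E x x = c := by
  obtain ⟨f, hf⟩ := S.exists_coeff_of_mem_boseMesner hE
  have hd : ∀ x, E x x = f 0 := fun x => hf 0 x x (by rw [S.diag]; rfl)
  have hsq : ∀ x, f 0 = ∑ z, E x z ^ 2 := by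
    intro x
    rw [← hd x]
    conv_lhs => rw [← hEE, Matrix.mul_apply]
    exact Finset.sum_congr rfl fun z _ => by
      rw [(S.isSymm_of_mem_boseMesner hE).apply x z, sq]
  refine ⟨f 0, ?_, hd⟩
  obtain ⟨x, y, hxy⟩ : ∃ x y, E x y ≠ 0 := by
    by_contra! h
    exact h0 (Matrix.ext h)
  rw [hsq x]
  exact Finset.sum_pos' (fun _ _ => sq_nonneg _) ⟨y, Finset.mem_univ _, by positivity⟩

/-- `E` takes a single value on `R r`, so the diagonal entries of the eigenvalue equation give three
times that value as θ c. -/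
theorem isCubicRep_scaledCol [DecidableEq X] (r : Fin (d + 1)) (hr : r ≠ 0)
    (hval : S.valency r = 3) {E : Matrix X X ℝ} (hE : E ∈ S.boseMesner) (hEE : E * E = E)
    {c : ℝ} (hc : 0 < c) (hd : ∀ x, E x x = c) {θ : ℝ} (hθ : S.relMatrix r * E = θ • E) :
    IsCubicRep (S.schemeGraph r hr) (scaledCol E c) θ := by
  have hsymm := S.isSymm_of_mem_boseMesner hE
  obtain ⟨f, hf⟩ := S.exists_coeff_of_mem_boseMesner hE
  have hsum : ∀ {x y p q : X}, p ≠ y → q ≠ y → p ≠ q → {z : X | (x, z) ∈ S.R r} = {y, p, q} →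
      ∀ z, E y z + E p z + E q z = θ * E x z := by
    intro x y p q hpy hqy hpq hset z
    rw [← S.relMatrix_mul_apply r E hpy hqy hpq hset, hθ]
    rfl
  have hmem : ∀ {x y p q : X}, {z : X | (x, z) ∈ S.R r} = {y, p, q} →
      (x, p) ∈ S.R r ∧ (x, q) ∈ S.R r := by
    intro x y p q hset
    have hp : p ∈ {z : X | (x, z) ∈ S.R r} := by rw [hset]; simp
    have hq : q ∈ {z : X | (x, z) ∈ S.R r} := by rw [hset]; simp
    exact ⟨hp, hq⟩
  refine ⟨fun x => ?_, fun x y hxy => ?_, fun x y hxy => ?_⟩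
  · have h := inner_scaledCol hc hsymm hEE x x
    rw [hd, div_self hc.ne', real_inner_self_eq_norm_sq] at h
    exact (pow_eq_one_iff_of_nonneg (norm_nonneg _) two_ne_zero).mp h
  · rw [inner_scaledCol hc hsymm hEE]
    obtain ⟨p, q, hpy, hqy, hpq, hset⟩ := S.exists_neighbors r hval hxy
    have h := hsum hpy hqy hpq hset x
    rw [hd, hf r y x (S.symm r x y hxy), hf r p x (S.symm r x p (hmem hset).1),
      hf r q x (S.symm r x q (hmem hset).2)] at h
    rw [hf r x y hxy]
    field_simp
    linarith
  · obtain ⟨p, q, hpy, hqy, hpq, hset⟩ := S.exists_neighbors r hval hxy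
    refine ⟨p, q, (hmem hset).1, (hmem hset).2, hpy, hqy, hpq, fun z hz => ?_, ?_⟩
    · have : z ∈ ({y, p, q} : Set X) := hset ▸ hz
      simpa using this
    · ext z
      have h := hsum hpy hqy hpq hset z
      simp only [Submodule.coe_add, Submodule.coe_smul, WithLp.ofLp_add, WithLp.ofLp_smul,
        Pi.add_apply, Pi.smul_apply, smul_eq_mul, coe_scaledCol_apply]
      rw [← hsymm.apply, ← hsymm.apply z p, ← hsymm.apply z q, ← hsymm.apply z x]
      linear_combination (√c)⁻¹ * h

/-- The characteristic polynomial of the adjacency matrix works: a nonzero column of `E` is an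
eigenvector for θ. -/
theorem exists_charpoly [DecidableEq X] (r : Fin (d + 1)) (hr : r ≠ 0)
    (hval : S.valency r = 3) {E : Matrix X X ℝ} (h0 : E ≠ 0) {θ : ℝ}
    (hθ : S.relMatrix r * E = θ • E) : ∃ p : Polynomial ℤ, Polynomial.aeval θ p = 0 ∧
      ∀ z : ℂ, Polynomial.aeval z p = 0 → ∃ s : ℝ, z = s ∧ |s| ≤ 3 := by
  classical
  let B : Matrix X X ℤ := Matrix.of fun x y => if (x, y) ∈ S.R r then 1 else 0
  have hB : S.relMatrix r = B.map (algebraMap ℤ ℝ) := by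
    ext x y
    simp [B, relMatrix]
  refine ⟨B.charpoly, ?_, exists_real_of_aeval_charpoly B ?_ ?_ ?_⟩
  · rw [← Polynomial.eval_map_algebraMap, ← Matrix.charpoly_map, ← hB]
    apply Matrix.mem_spectrum_iff_isRoot_charpoly.mp
    rw [← Matrix.spectrum_toLin', ← Module.End.hasEigenvalue_iff_mem_spectrum]
    obtain ⟨y, hy⟩ : ∃ y, E.col y ≠ 0 := by
      by_contra! h
      exact h0 (Matrix.ext fun x y => congrFun (h y) x)
    refine Module.End.hasEigenvalue_of_hasEigenvector (x := E.col y)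
      ⟨Module.End.mem_eigenspace_iff.mpr ?_, hy⟩
    ext x
    exact congrFun (congrFun hθ x) y
  · ext x y
    simp only [B, Matrix.transpose_apply, Matrix.of_apply]
    congr 1
    exact propext ⟨S.symm r y x, S.symm r x y⟩
  · intro x
    simp only [B, Matrix.of_apply, ite_eq_right_iff, one_ne_zero, imp_false]
    intro h
    exact hr (S.rel_unique h (by rw [S.diag]; rfl))
  · intro x
    have h1 : ∀ y, |B x y| = if (x, y) ∈ S.R r then 1 else 0 := by
      intro y
      simp only [B, Matrix.of_apply]
      split_ifs <;> rfl
    rw [Finset.sum_congr rfl fun y _ => h1 y, Finset.sum_boole]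
    have h2 := S.ncard_neighbors r x
    rw [hval, Set.ncard_eq_toFinset_card', Set.toFinset_ofPred] at h2
    rw [h2]; rfl

end AssociationScheme

/-! ### Excluding θ² = 9, and the conclusion -/

/-- A cubic representation of a connected graph with `θ ^ 2 = 9` spans at most a line. -/
theorem IsCubicRep.sq_ne_nine {X V : Type*} [NormedAddCommGroup V] [InnerProductSpace ℝ V]
    {G : SimpleGraph X} {v : X → V} {θ : ℝ} (h : IsCubicRep G v θ) (hG : G.Connected)
    (hspan : Submodule.span ℝ (Set.range v) = ⊤) (hV : 1 < Module.finrank ℝ V) : θ ^ 2 ≠ 9 := by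
  intro h9
  obtain ⟨x₀⟩ := hG.nonempty
  have hadj : ∀ x y, G.Adj x y → v y = (θ / 3) • v x := by
    intro x y hxy
    -- The squared norm of the difference is 1 - θ²/9, the equality case of Cauchy-Schwarz.
    rw [← sub_eq_zero, ← inner_self_eq_zero (𝕜 := ℝ)]
    have hyx : ⟪v y, v x⟫ = θ / 3 := by rw [real_inner_comm, h.inner_adj x y hxy]
    simp only [inner_sub_left, inner_sub_right, inner_smul_left, inner_smul_right, conj_trivial,
      h.inner_self, h.inner_adj x y hxy, hyx]
    linarith
  have hmem : ∀ x, v x ∈ Submodule.span ℝ {v x₀} := by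
    intro x
    obtain ⟨w⟩ := hG.preconnected x x₀
    induction w with
    | nil => exact Submodule.mem_span_singleton_self _
    | cons hxy _ ih =>
      rw [hadj _ _ hxy.symm]
      exact Submodule.smul_mem _ _ ih
  have htop : Submodule.span ℝ {v x₀} = ⊤ := by
    rw [eq_top_iff, ← hspan, Submodule.span_le]
    rintro _ ⟨x, rfl⟩
    exact hmem x
  have hle := finrank_span_le_card (R := ℝ) ({v x₀} : Set V)
  rw [htop, finrank_top] at hle
  simp at hle
  omega

theorem mainTheorem3 {X : Type*} [Fintype X] [DecidableEq X] {d : ℕ} (hd : 3 ≤ d + 1)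
    (S : AssociationScheme X d) (r : Fin (d + 1)) (hr : r ≠ 0)
    (hconn : (S.schemeGraph r hr).Connected) (hval : S.valency r = 3)
    (E : Matrix X X ℝ) (hE : S.IsMinimalIdempotent E) (hmult : E.rank = 3)
    (θ : ℝ) (hθ : S.relMatrix r * E = θ • E) :
    θ ∈ ({1, -1, √5, -√5} : Set ℝ) ∧
      ((θ = √5 ∨ θ = -√5) → (S.schemeGraph r hr).HasIntersectionNumberC 3 1) := by
  obtain ⟨hmem, hEE, h0, -⟩ := hE
  obtain ⟨c, hc, hdiag⟩ := S.exists_diag_pos hmem hEE h0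
  have hrep := S.isCubicRep_scaledCol r hr hval hmem hEE hc hdiag hθ
  have hV : Module.finrank ℝ (LinearMap.range (Matrix.toEuclideanLin E)) = 3 := by
    rw [finrank_range_toEuclideanLin, hmult]
  have h9 := hrep.sq_ne_nine hconn (span_range_scaledCol hc) (by rw [hV]; norm_num)
  obtain ⟨⟨x, y⟩, hxy⟩ := S.nonempty r
  have hadj : (S.schemeGraph r hr).Adj x y := hxy
  obtain ⟨p, hp, hroots⟩ := S.exists_charpoly r hr hval h0 hθ
  have h5 : (√5 : ℝ) ^ 2 = 5 := Real.sq_sqrt (by norm_num)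
  refine ⟨?_, fun hθ5 => hrep.hasIntersectionNumberC hV hconn ?_ hadj⟩
  · simp only [Set.mem_insert_iff, Set.mem_singleton_iff]
    rcases sq_eq_of_conjugates (hrep.isIntegral hV h9 hadj) p hp hroots with h | h | h
    · rcases sq_eq_sq_iff_eq_or_eq_neg.mp (h.trans (one_pow 2).symm) with h | h <;> simp [h]
    · rw [← h5] at h
      rcases sq_eq_sq_iff_eq_or_eq_neg.mp h with h | h <;> simp [h]
    · exact absurd h h9
  · rcases hθ5 with h | h <;> rw [h]
    · exact h5
    · rw [neg_sq, h5]
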